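/- **Model.** There are finitely many keywords $q$, a nonempty finite set of clients $i$, $L$ webpage slots $s$, and for each $q$ a set $\mathcal M_q$ of $0/1$ matrices $M=(M_{is})$ in which every row and every column contains at most one $1$ ($M_{is}=1$ means that client $i$ is shown in slot $s$). In each time slot a query for $q$ arrives with probability $\nu_q=\nu\vartheta_q$ and no query arrives with probability $1-\nu$, independently over time slots, where $\nu\in(0,1)$, $\vartheta_q\ge 0$ and $\sum_q\vartheta_q=1$. Let $c_{qis}\in[0,1]$ be the click-through rates, $m_i\ge 0$ the average impression requirement of client $i$ per requirement cycle, and $N\ge1$ the number of time slots in a cycle. The integer requirement $\tilde m_i(k)$ of client $i$ in cycle $k$ equals $\lceil m_i\rceil$ with probability $m_i-\lfloor m_i\rfloor$ and $\lfloor m_i\rfloor$ otherwise. The vectors $(\tilde m_i(k))_i$ are i.i.d. over $k$ and independent of the queries (for one and the same $k$ their entries may be coupled in any way). **Online algorithm with parameter $\epsilon>0$.** If a query for $q$ arrives in a time slot of cycle $k$, choose $$\tilde M^*\in\arg\max_{M\in\mathcal M_q}\sum_{i,s}M_{is}\Big(\frac{c_{qis}}{\epsilon}+Q_i(k)\Big)$$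 by a fixed rule depending only on the position of the time slot in the cycle, on $q$, and on $\mathbf Q(k)$ (ties are broken arbitrarily). At the end of the cycle set $Q_i(k+1)=[Q_i(k)+\tilde m_i(k)-S_i(k)]^+$, where $S_i(k)$ is the number of impressions of client $i$ in cycle $k$. The credit queues $\mathbf Q(k)$ take values in the nonnegative integer vectors and form a time-homogeneous Markov chain. **Constants.** Let $\mathcal F_0$ be the set of families $\mathbf p=(p_{qM})_{q,\,M\in\mathcal M_q}$ with $0\le p_{qM}\le1$ and $\sum_{M\in\mathcal M_q}p_{qM}\le 1$ for every $q$. Let $$\bar J(\mathbf p)=\sum_q\nu_q\sum_{M\in\mathcal M_q}p_{qM}\sum_{i,s}M_{is}c_{qis},\qquad D_2(\mathbf p)=\min_i\Big\{N\sum_q\nu_q\sum_{M\in\mathcal M_q}p_{qM}\sum_sM_{is}-m_i\Big\},$$ $$D_1=\tfrac12\Big(N(N-1)L^2+NL+\sum_i\big(\lceil m_i\rceil^2(m_i-\lfloor m_i\rfloor)+\lfloor m_i\rfloor^2(1-m_i+\lfloor m_i\rfloor)\big)\Big),$$ $$D_3=N\max_{\mathbf p\in\mathcal F_0}\bar J(\mathbf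 p),\qquad D_2^*=\max_{\mathbf p\in\mathcal F_0}D_2(\mathbf p).$$ Let $\mathcal F$ be the set of those $\mathbf p\in\mathcal F_0$ with $N\sum_q\nu_q\sum_{M\in\mathcal M_q}p_{qM}\sum_sM_{is}\ge m_i$ for all $i$. **Theorem.** Assume that $D_2(\hat{\mathbf p})>0$ for some $\hat{\mathbf p}\in\mathcal F$. Then, under the online algorithm with any $\epsilon>0$, the chain $\mathbf Q(k)$ has a stationary distribution, and for every random vector $\mathbf Q(\infty)$ whose law is a stationary distribution of the chain, $$E\Big[\sum_iQ_i(\infty)\Big]\le\frac1{D_2^*}\Big(D_1+\frac{D_3}{\epsilon}\Big).$$ Moreover, for every deterministic initial state $\mathbf Q(0)$, $$\limsup_{K\to\infty}\frac1K\sum_{k=0}^{K-1}E\Big[\sum_iQ_i(k)\Big]\le\frac1{D_2^*}\Big(D_1+\frac{D_3}{\epsilon}\Big).$$ -/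

import Mathlib

open scoped ENNReal

/-- `M i s = 1` when client `i` occupies webpage slot `s`, and `M i s = 0` otherwise; a slot goes
to at most one client and a client gets at most one slot. -/
def IsAssignment {ι : Type*} [Fintype ι] {L : ℕ} (M : Matrix ι (Fin L) ℕ) : Prop :=
  (∀ i s, M i s = 0 ∨ M i s = 1) ∧ (∀ i, ∑ s, M i s ≤ 1) ∧ (∀ s, ∑ i, M i s ≤ 1)

/-- Randomized rounding of `x ≥ 0` to an integer: `⌈x⌉` with probability `x - ⌊x⌋`, and `⌊x⌋`
otherwise. -/
noncomputable def roundingLaw (x : ℝ) : PMF ℕ :=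
  (PMF.ofFintype
    (fun up : Bool => if up then ENNReal.ofReal (x - ⌊x⌋) else ENNReal.ofReal (1 - (x - ⌊x⌋)))
    (by
      have h := Int.fract_nonneg x
      have h' := Int.fract_lt_one x
      unfold Int.fract at h h'
      simp only [Fintype.sum_bool, if_true, Bool.false_eq_true, if_false]
      rw [← ENNReal.ofReal_add h (by linarith)]
      simp)).map
    fun up => if up then ⌈x⌉₊ else ⌊x⌋₊

/-- The click-through-rate maximization model with impression requirements, for the finite set `κ`
of keywords and the finite set `ι` of clients. -/
structure AdModel (κ ι : Type*) [Fintype κ] [Fintype ι] where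
  /-- number of webpage slots -/
  L : ℕ
  /-- number of time slots in a requirement cycle -/
  N : ℕ
  N_pos : 0 < N
  /-- probability that a query arrives in a time slot -/
  arrival : ℝ
  arrival_pos : 0 < arrival
  arrival_lt_one : arrival < 1
  /-- probability that an arriving query is for a given keyword -/
  share : κ → ℝ
  share_nonneg : ∀ q, 0 ≤ share q
  share_sum : ∑ q, share q = 1
  /-- click-through rates -/
  ctr : κ → ι → Fin L → ℝ
  ctr_nonneg : ∀ q i s, 0 ≤ ctr q i s
  ctr_le_one : ∀ q i s, ctr q i s ≤ 1
  /-- the assignment matrices admitted for a keyword -/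
  mats : κ → Finset (Matrix ι (Fin L) ℕ)
  isAssignment_of_mem : ∀ q, ∀ M ∈ mats q, IsAssignment M
  /-- average impression requirement per requirement cycle -/
  m : ι → ℝ
  m_nonneg : ∀ i, 0 ≤ m i
  /-- joint law, in one requirement cycle, of the integer-valued requirements of the clients;
  only its marginals are prescribed, the clients may be coupled or independent -/
  reqLaw : PMF (ι → ℕ)
  reqLaw_marginal : ∀ i, reqLaw.map (fun r => r i) = roundingLaw (m i)

namespace AdModel

variable {κ ι : Type*} [Fintype κ] [Fintype ι] (A : AdModel κ ι)

/-- Arrival rate of queries for keyword `q`. -/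
def rate (q : κ) : ℝ := A.arrival * A.share q

/-! ### The static optimization problem -/

/-- Families `p = (p q M)`, `M` ranging over the matrices admitted for the keyword `q`. -/
abbrev Policy : Type _ := (q : κ) → {M // M ∈ A.mats q} → ℝ

/-- Average total click-through rate (per time slot). -/
def clickRate (p : A.Policy) : ℝ :=
  ∑ q, A.rate q * ∑ M : {M // M ∈ A.mats q}, p q M *
    ∑ i, ∑ s, (M.1 i s : ℝ) * A.ctr q i s

/-- Average number of impressions of client `i` per requirement cycle. -/
def impressions (p : A.Policy) (i : ι) : ℝ :=
  A.N * ∑ q, A.rate q * ∑ M : {M // M ∈ A.mats q}, p q M * ∑ s, (M.1 i s : ℝ)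

/-- The relaxed feasible set, without the impression requirements. -/
def relaxedFeasible : Set A.Policy :=
  {p | (∀ q M, 0 ≤ p q M ∧ p q M ≤ 1) ∧ ∀ q, ∑ M, p q M ≤ 1}

/-- The feasible set. -/
def feasible : Set A.Policy :=
  {p | p ∈ A.relaxedFeasible ∧ ∀ i, A.m i ≤ A.impressions p i}

/-! ### The constants -/

noncomputable def D₁ : ℝ :=
  (1 / 2) * ((A.N : ℝ) * ((A.N : ℝ) - 1) * (A.L : ℝ) ^ 2 + (A.N : ℝ) * (A.L : ℝ)
    + ∑ i, ((⌈A.m i⌉ : ℝ) ^ 2 * (A.m i - (⌊A.m i⌋ : ℝ))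
        + (⌊A.m i⌋ : ℝ) ^ 2 * (1 - A.m i + (⌊A.m i⌋ : ℝ))))

/-- The least surplus of impressions over all clients. -/
noncomputable def D₂ [Nonempty ι] (p : A.Policy) : ℝ :=
  Finset.univ.inf' Finset.univ_nonempty fun i => A.impressions p i - A.m i

/-- The maximum of `D₂` over the relaxed feasible set (attained: see `isGreatest_D₂max`). -/
noncomputable def D₂max [Nonempty ι] : ℝ := sSup (A.D₂ '' A.relaxedFeasible)

/-- `N` times the maximal click-through rate over the relaxed feasible set (attained: see
`isGreatest_clickRate`). -/
noncomputable def D₃ : ℝ := A.N * sSup (A.clickRate '' A.relaxedFeasible)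

theorem isCompact_relaxedFeasible : IsCompact A.relaxedFeasible := by
  have h1 : IsCompact (Set.univ.pi fun q : κ => Set.univ.pi
      fun _ : {M // M ∈ A.mats q} => Set.Icc (0 : ℝ) 1) :=
    isCompact_univ_pi fun q => isCompact_univ_pi fun _ => isCompact_Icc
  have h2 : IsClosed {p : A.Policy | ∀ q, ∑ M, p q M ≤ 1} := by
    rw [show {p : A.Policy | ∀ q, ∑ M, p q M ≤ 1} = ⋂ q, {p : A.Policy | ∑ M, p q M ≤ 1} by
      ext; simp]
    exact isClosed_iInter fun q => isClosed_le (by fun_prop) continuous_const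
  convert h1.inter_right h2 using 1
  ext p
  simp only [relaxedFeasible, Set.mem_inter_iff, Set.mem_univ_pi, Set.mem_Icc, Set.mem_ofPred_eq]

theorem relaxedFeasible_nonempty : A.relaxedFeasible.Nonempty :=
  ⟨fun _ _ => 0, by simp [relaxedFeasible]⟩

theorem isGreatest_clickRate :
    IsGreatest (A.clickRate '' A.relaxedFeasible) (sSup (A.clickRate '' A.relaxedFeasible)) :=
  (A.isCompact_relaxedFeasible.image (by unfold clickRate; fun_prop)).isGreatest_sSup
    (A.relaxedFeasible_nonempty.image _)

theorem isGreatest_D₂max [Nonempty ι] : IsGreatest (A.D₂ '' A.relaxedFeasible) A.D₂max :=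
  (A.isCompact_relaxedFeasible.image (by
    unfold D₂
    refine Continuous.finset_inf'_apply _ fun i _ => ?_
    unfold impressions
    fun_prop)).isGreatest_sSup (A.relaxedFeasible_nonempty.image _)

/-! ### The stochastic model and the online algorithm -/

/-- Law of the query in one time slot; `none` means that no query arrives. -/
noncomputable def queryLaw : PMF (Option κ) :=
  PMF.ofFintype
    (fun o => o.elim (ENNReal.ofReal (1 - A.arrival)) fun q => ENNReal.ofReal (A.rate q))
    (by
      have h0 : ∀ q, 0 ≤ A.rate q := fun q => mul_nonneg A.arrival_pos.le (A.share_nonneg q)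
      rw [Fintype.sum_option]
      simp only [Option.elim]
      rw [← ENNReal.ofReal_sum_of_nonneg fun q _ => h0 q,
        ← ENNReal.ofReal_add (by linarith [A.arrival_lt_one]) (Finset.sum_nonneg fun q _ => h0 q)]
      simp [rate, ← Finset.mul_sum, A.share_sum])

/-- Law of the queries in one requirement cycle: independent over the `N` time slots. -/
noncomputable def cycleQueryLaw : PMF (Fin A.N → Option κ) :=
  PMF.ofFintype (fun u => ∏ j, A.queryLaw (u j)) (by
    classical
    rw [← Fintype.piFinset_univ, ← Finset.prod_univ_sum]
    refine Finset.prod_eq_one fun j _ => ?_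
    rw [← tsum_fintype (L := .unconditional _)]
    exact A.queryLaw.tsum_coe)

/-- A rule that chooses, in the `j`-th time slot of a requirement cycle, an assignment matrix from
the queried keyword and the credit queues at the beginning of the cycle. -/
abbrev Rule : Type _ := Fin A.N → κ → (ι → ℕ) → Matrix ι (Fin A.L) ℕ

/-- The rules of the online algorithm with parameter `ε`: the chosen matrix is an admitted matrix
of maximal weight, ties being broken arbitrarily. -/
def IsOnline (ε : ℝ) (rule : A.Rule) : Prop :=
  ∀ j q Q, rule j q Q ∈ A.mats q ∧ ∀ M ∈ A.mats q,
    ∑ i, ∑ s, (M i s : ℝ) * (A.ctr q i s / ε + (Q i : ℝ))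
      ≤ ∑ i, ∑ s, (rule j q Q i s : ℝ) * (A.ctr q i s / ε + (Q i : ℝ))

variable {A}

/-- Number of impressions of client `i` in a requirement cycle with queries `u`, when the queues at
the beginning of the cycle are `Q`. -/
def served (rule : A.Rule) (Q : ι → ℕ) (u : Fin A.N → Option κ) (i : ι) : ℕ :=
  ∑ j, (u j).elim 0 fun q => ∑ s, rule j q Q i s

/-- The update of the credit queues at the end of a requirement cycle. Subtraction of natural
numbers is truncated at `0`, so this is `[Q i + r i - served i]⁺`. -/
def update (rule : A.Rule) (Q : ι → ℕ) (u : Fin A.N → Option κ) (r : ι → ℕ) : ι → ℕ :=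
  fun i => Q i + r i - served rule Q u i

/-- Transition law of the Markov chain of credit queues: the queries and the requirements of a cycle
are independent of each other and of the past. -/
noncomputable def step (rule : A.Rule) (Q : ι → ℕ) : PMF (ι → ℕ) :=
  A.cycleQueryLaw.bind fun u => A.reqLaw.map fun r => update rule Q u r

/-- Law of the queues at the beginning of cycle `k`, started from the queues `Q₀`. -/
noncomputable def queueLaw (rule : A.Rule) (Q₀ : ι → ℕ) : ℕ → PMF (ι → ℕ)
  | 0 => PMF.pure Q₀
  | k + 1 => (queueLaw rule Q₀ k).bind (step rule)

/-- `π` is a steady-state law (stationary distribution) of the queues. -/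
def IsSteadyState (rule : A.Rule) (π : PMF (ι → ℕ)) : Prop :=
  π.bind (step rule) = π

end AdModel

/-- Expected total queue length `E[∑ i, Q i]`, in `[0, ∞]`, for queues `Q` with law `μ`. -/
noncomputable def meanTotal {ι : Type*} [Fintype ι] (μ : PMF (ι → ℕ)) : ℝ≥0∞ :=
  ∑' Q : ι → ℕ, μ Q * ((∑ i, Q i : ℕ) : ℝ≥0∞)

open Filter Topology

/-!
The sum of the squared queues is a Foster–Lyapunov function. Using in each slot the matrix chosen by
the online algorithm is, on average over a cycle, a static policy, and this policy maximizes
`N J(p) / ε + ∑ i, Q i * impressions p i` over the relaxed feasible set. Comparing it with a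
maximizer of `D₂` bounds the one-cycle drift by `2 (D₁ + D₃ / ε) - 2 D₂max ∑ i, Q i`.

Telescoping the drift bounds the time averages of the expected queues. The occupation laws are
therefore tight, and each of their limit points is stationary. A stationary law may give the
Lyapunov function infinite expectation; truncating the function keeps the drift inequality on its
sublevel sets, where it gives the bound.
-/

section Expectation

variable {α β : Type*}

/-- Expectation of a `[0, ∞]`-valued function under a discrete law, as a sum, so that neither
measurability nor integrability has to be assumed. -/
noncomputable def lexpect (μ : PMF α) (f : α → ℝ≥0∞) : ℝ≥0∞ := ∑' a, μ a * f a

theorem lexpect_pure (a : α) (f : α → ℝ≥0∞) : lexpect (PMF.pure a) f = f a := by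
  rw [lexpect, tsum_eq_single a fun b hb => by simp [hb]]
  simp

theorem lexpect_bind (μ : PMF α) (P : α → PMF β) (f : β → ℝ≥0∞) :
    lexpect (μ.bind P) f = lexpect μ fun a => lexpect (P a) f := by
  simp_rw [lexpect, PMF.bind_apply, ← ENNReal.tsum_mul_right, ← ENNReal.tsum_mul_left, mul_assoc]
  exact ENNReal.tsum_comm

theorem lexpect_map (μ : PMF α) (g : α → β) (f : β → ℝ≥0∞) :
    lexpect (μ.map g) f = lexpect μ fun a => f (g a) := by
  simp only [PMF.map, lexpect_bind, Function.comp_apply, lexpect_pure]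

theorem lexpect_const (μ : PMF α) (c : ℝ≥0∞) : lexpect μ (fun _ => c) = c := by
  rw [lexpect, ENNReal.tsum_mul_right, μ.tsum_coe, one_mul]

theorem lexpect_mono (μ : PMF α) {f g : α → ℝ≥0∞} (h : ∀ a, f a ≤ g a) :
    lexpect μ f ≤ lexpect μ g :=
  ENNReal.tsum_le_tsum fun a => mul_le_mul_right (h a) _

theorem lexpect_add (μ : PMF α) (f g : α → ℝ≥0∞) :
    lexpect μ (fun a => f a + g a) = lexpect μ f + lexpect μ g := by
  simp only [lexpect, mul_add, ENNReal.tsum_add]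

theorem lexpect_const_mul (μ : PMF α) (c : ℝ≥0∞) (f : α → ℝ≥0∞) :
    lexpect μ (fun a => c * f a) = c * lexpect μ f := by
  simp only [lexpect, mul_left_comm _ c, ENNReal.tsum_mul_left]

theorem lexpect_finsetSum {γ : Type*} (μ : PMF α) (s : Finset γ) (f : γ → α → ℝ≥0∞) :
    lexpect μ (fun a => ∑ i ∈ s, f i a) = ∑ i ∈ s, lexpect μ (f i) := by
  simp only [lexpect, Finset.mul_sum]
  exact Summable.tsum_finsetSum fun _ _ => ENNReal.summable

theorem lexpect_min_const_le (μ : PMF α) (f : α → ℝ≥0∞) (c : ℝ≥0∞) :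
    lexpect μ (fun a => min (f a) c) ≤ min (lexpect μ f) c :=
  le_min (lexpect_mono μ fun _ => min_le_left _ _)
    ((lexpect_mono μ fun _ => min_le_right _ _).trans_eq (lexpect_const μ c))

theorem lexpect_uniformOfFinset (s : Finset α) (hs : s.Nonempty) (f : α → ℝ≥0∞) :
    lexpect (PMF.uniformOfFinset s hs) f = (∑ a ∈ s, f a) / s.card := by
  rw [lexpect, tsum_eq_sum (s := s) fun a ha => by simp [ha], ENNReal.div_eq_inv_mul,
    Finset.mul_sum]
  exact Finset.sum_congr rfl fun a ha => by rw [PMF.uniformOfFinset_apply_of_mem hs ha]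

theorem le_mul_sum_add_lexpect (μ : PMF α) {f : α → ℝ≥0∞} {c : ℝ≥0∞} {s : Finset α}
    (hs : ∀ a ∉ s, c ≤ f a) : c ≤ c * ∑ a ∈ s, μ a + lexpect μ f := by
  classical
  calc c = lexpect μ fun _ => c := (lexpect_const μ c).symm
    _ ≤ ∑' a, ((s : Set α).indicator (fun a => c * μ a) a + μ a * f a) := by
        refine ENNReal.tsum_le_tsum fun a => ?_
        by_cases ha : a ∈ s
        · simp [ha, mul_comm]
        · exact le_add_left (mul_le_mul_right (hs a ha) _)
    _ = c * ∑ a ∈ s, μ a + lexpect μ f := by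
        rw [ENNReal.tsum_add, ← sum_eq_tsum_indicator, Finset.mul_sum, lexpect]

theorem pmf_eq_of_forall_le {μ ν : PMF α} (h : ∀ a, μ a ≤ ν a) : μ = ν := by
  by_contra hne
  obtain ⟨a, ha⟩ : ∃ a, μ a ≠ ν a := by simpa [PMF.ext_iff] using hne
  have hlt := ENNReal.tsum_lt_tsum μ.tsum_coe_ne_top h ((h a).lt_of_ne ha)
  simp [PMF.tsum_coe] at hlt

end Expectation

section Compactness

variable {α γ : Type*}

theorem tendsto_const_div_natCast {c : ℝ≥0∞} (hc : c ≠ ∞) :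
    Tendsto (fun n : ℕ => c / n) atTop (𝓝 0) := by
  simpa using ENNReal.Tendsto.const_div ENNReal.tendsto_nat_nhds_top (Or.inr hc)

/-- A bound on a coercive moment is tightness: no mass escapes in the limit. -/
theorem exists_pmf_tendsto_of_lexpect_le (U : Ultrafilter γ) {ν : γ → PMF α} {f : α → ℝ≥0∞}
    {C : ℝ≥0∞} (hC : C ≠ ∞) (hf : ∀ n : ℕ, {a | f a ≤ n}.Finite)
    (hν : ∀ K, lexpect (ν K) f ≤ C) :
    ∃ π : PMF α, ∀ a, Tendsto (fun K => ν K a) U (𝓝 (π a)) := by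
  have hlim : ∀ a, ∃ x, Tendsto (fun K => ν K a) U (𝓝 x) := fun a =>
    ⟨_, (U.map fun K => ν K a).le_nhds_lim⟩
  choose p hp using hlim
  have hsum : ∀ s : Finset α, Tendsto (fun K => ∑ a ∈ s, ν K a) U (𝓝 (∑ a ∈ s, p a)) :=
    fun s => tendsto_finsetSum s fun a _ => hp a
  have hle : ∑' a, p a ≤ 1 := by
    rw [ENNReal.tsum_eq_iSup_sum]
    exact iSup_le fun s => le_of_tendsto' (hsum s) fun K =>
      (ENNReal.sum_le_tsum s).trans (ν K).tsum_coe.le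
  have hmarkov : ∀ n : ℕ, (n : ℝ≥0∞) ≤ n * ∑' a, p a + C := by
    intro n
    set s := (hf n).toFinset
    have hs : ∀ a ∉ s, (n : ℝ≥0∞) ≤ f a := fun a ha => by
      have : ¬ f a ≤ n := by simpa [s] using ha
      exact (not_le.1 this).le
    calc (n : ℝ≥0∞) ≤ n * ∑ a ∈ s, p a + C :=
          ge_of_tendsto' ((ENNReal.Tendsto.const_mul (hsum s)
            (Or.inr (ENNReal.natCast_ne_top n))).add_const C) fun K =>
              (le_mul_sum_add_lexpect (ν K) hs).trans (add_le_add_right (hν K) _)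
      _ ≤ n * ∑' a, p a + C := by gcongr; exact ENNReal.sum_le_tsum s
  have hge : 1 ≤ ∑' a, p a := by
    have hlim := (tendsto_const_div_natCast hC).const_add (∑' a, p a)
    rw [add_zero] at hlim
    refine ge_of_tendsto hlim ((eventually_ne_atTop 0).mono fun n hn => ?_)
    have hn : (n : ℝ≥0∞) ≠ 0 := Nat.cast_ne_zero.2 hn
    have hn' := ENNReal.natCast_ne_top n
    rw [← ENNReal.mul_le_mul_iff_right hn hn', mul_one, mul_add, ENNReal.mul_div_cancel hn hn']
    exact hmarkov n
  exact ⟨⟨p, hle.antisymm hge ▸ ENNReal.summable.hasSum⟩, hp⟩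

theorem bind_eq_self_of_tendsto {l : Filter γ} [l.NeBot] {P : α → PMF α} {ν : γ → PMF α}
    {π : PMF α} {δ : γ → ℝ≥0∞} (hδ : Tendsto δ l (𝓝 0))
    (hν : ∀ a, Tendsto (fun K => ν K a) l (𝓝 (π a)))
    (hinv : ∀ K a, (ν K).bind P a ≤ ν K a + δ K) : π.bind P = π := by
  refine pmf_eq_of_forall_le fun a => ?_
  rw [PMF.bind_apply, ENNReal.tsum_eq_iSup_sum]
  refine iSup_le fun s => ?_
  have hleft : Tendsto (fun K => ∑ y ∈ s, ν K y * P y a) l (𝓝 (∑ y ∈ s, π y * P y a)) :=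
    tendsto_finsetSum s fun y _ =>
      ENNReal.Tendsto.mul_const (hν y) (Or.inr ((P y).apply_ne_top a))
  have hright : Tendsto (fun K => ν K a + δ K) l (𝓝 (π a)) := by
    simpa using (hν a).add hδ
  exact le_of_tendsto_of_tendsto' hleft hright fun K =>
    (ENNReal.sum_le_tsum s).trans (hinv K a)

end Compactness

section Chain

variable {α : Type*} (P : α → PMF α) (μ : PMF α)

/-- Law at time `k` of the Markov chain with transition law `P` and initial law `μ`. -/
noncomputable def chainLaw (k : ℕ) : PMF α := (fun ν => ν.bind P)^[k] μ

theorem chainLaw_succ (k : ℕ) : chainLaw P μ (k + 1) = (chainLaw P μ k).bind P :=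
  Function.iterate_succ_apply' ..

/-- The occupation law of the chain over the times `0, …, K`; these are `K + 1` times, so that it is
a probability law for every `K`. -/
noncomputable def occupationLaw (K : ℕ) : PMF α :=
  (PMF.uniformOfFinset (Finset.range (K + 1)) Finset.nonempty_range_add_one).bind (chainLaw P μ)

theorem lexpect_occupationLaw (K : ℕ) (f : α → ℝ≥0∞) :
    lexpect (occupationLaw P μ K) f
      = (∑ k ∈ Finset.range (K + 1), lexpect (chainLaw P μ k) f) / (K + 1 : ℕ) := by
  rw [occupationLaw, lexpect_bind, lexpect_uniformOfFinset, Finset.card_range]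

theorem occupationLaw_apply (K : ℕ) (a : α) :
    occupationLaw P μ K a
      = (∑ k ∈ Finset.range (K + 1), chainLaw P μ k a) / (K + 1 : ℕ) := by
  have h := lexpect_uniformOfFinset (Finset.range (K + 1)) Finset.nonempty_range_add_one
    fun k => chainLaw P μ k a
  rwa [Finset.card_range] at h

theorem occupationLaw_bind_apply_le (K : ℕ) (a : α) :
    (occupationLaw P μ K).bind P a ≤ occupationLaw P μ K a + 1 / (K + 1 : ℕ) := by
  calc (occupationLaw P μ K).bind P a
      = (∑ k ∈ Finset.range (K + 1), chainLaw P μ (k + 1) a) / (K + 1 : ℕ) := by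
        simp only [chainLaw_succ]
        exact lexpect_occupationLaw P μ K fun y => P y a
    _ ≤ (∑ k ∈ Finset.range (K + 1), chainLaw P μ k a + 1) / (K + 1 : ℕ) := by
        refine ENNReal.div_le_div_right ?_ _
        calc ∑ k ∈ Finset.range (K + 1), chainLaw P μ (k + 1) a
            ≤ ∑ k ∈ Finset.range (K + 2), chainLaw P μ k a := by
              rw [Finset.sum_range_succ' _ (K + 1)]
              exact le_self_add
          _ ≤ ∑ k ∈ Finset.range (K + 1), chainLaw P μ k a + 1 := by
              rw [Finset.sum_range_succ _ (K + 1)]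
              exact add_le_add_right (PMF.coe_le_one _ a) _
    _ = occupationLaw P μ K a + 1 / (K + 1 : ℕ) := by
        rw [ENNReal.add_div, occupationLaw_apply]

end Chain

/-- The Foster–Lyapunov drift condition `P W + f ≤ W + b` for a Markov chain with transition
law `P`, with Lyapunov function `W`. -/
def HasDrift {α : Type*} (P : α → PMF α) (W f : α → ℝ≥0∞) (b : ℝ≥0∞) : Prop :=
  ∀ a, lexpect (P a) W + f a ≤ W a + b

namespace HasDrift

variable {α : Type*} {P : α → PMF α} {W f : α → ℝ≥0∞} {b : ℝ≥0∞}

theorem const_mul (h : HasDrift P W f b) (c : ℝ≥0∞) :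
    HasDrift P (fun a => c * W a) (fun a => c * f a) (c * b) := fun a => by
  rw [lexpect_const_mul, ← mul_add, ← mul_add]
  exact mul_le_mul_right (h a) c

theorem lexpect_bind_add_le (h : HasDrift P W f b) (μ : PMF α) :
    lexpect (μ.bind P) W + lexpect μ f ≤ lexpect μ W + b := by
  rw [lexpect_bind, ← lexpect_add]
  exact (lexpect_mono μ h).trans_eq (by rw [lexpect_add, lexpect_const])

theorem lexpect_chainLaw_add_sum_le (h : HasDrift P W f b) (μ : PMF α) (K : ℕ) :
    lexpect (chainLaw P μ K) W + ∑ k ∈ Finset.range K, lexpect (chainLaw P μ k) f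
      ≤ lexpect μ W + K * b := by
  induction K with
  | zero => simp [chainLaw]
  | succ K ih =>
    rw [chainLaw_succ, Finset.sum_range_succ, add_comm (∑ k ∈ _, _), ← add_assoc]
    calc _ ≤ lexpect (chainLaw P μ K) W + b
            + ∑ k ∈ Finset.range K, lexpect (chainLaw P μ k) f :=
          add_le_add_left (h.lexpect_bind_add_le _) _
      _ = lexpect (chainLaw P μ K) W
            + ∑ k ∈ Finset.range K, lexpect (chainLaw P μ k) f + b := add_right_comm _ _ _
      _ ≤ lexpect μ W + K * b + b := add_le_add_left ih b
      _ = lexpect μ W + (K + 1 : ℕ) * b := by push_cast; ring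

theorem average_le (h : HasDrift P W f b) (μ : PMF α) {K : ℕ} (hK : K ≠ 0) :
    (∑ k ∈ Finset.range K, lexpect (chainLaw P μ k) f) / K ≤ lexpect μ W / K + b := by
  have hK₀ : (K : ℝ≥0∞) ≠ 0 := Nat.cast_ne_zero.2 hK
  have hK_top := ENNReal.natCast_ne_top K
  rw [ENNReal.div_le_iff hK₀ hK_top, add_mul, ENNReal.div_mul_cancel hK₀ hK_top, mul_comm b]
  exact le_add_self.trans (h.lexpect_chainLaw_add_sum_le μ K)

theorem limsup_average_le (h : HasDrift P W f b) {μ : PMF α} (hμ : lexpect μ W ≠ ∞) :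
    limsup (fun K : ℕ => (∑ k ∈ Finset.range K, lexpect (chainLaw P μ k) f) / (K : ℝ≥0∞)) atTop
      ≤ b := by
  have hlim : Tendsto (fun K : ℕ => lexpect μ W / K + b) atTop (𝓝 b) := by
    simpa using (tendsto_const_div_natCast hμ).add_const b
  rw [← hlim.limsup_eq]
  exact limsup_le_limsup ((eventually_ne_atTop 0).mono fun K hK => h.average_le μ hK)

/-- `W` need not be integrable under the stationary law, so the drift inequality cannot be
integrated as it stands; it is integrated for `min W c`, which gives the bound on `{W ≤ c}`. -/
theorem lexpect_le_of_bind_eq (h : HasDrift P W f b) (hW : ∀ a, W a ≠ ∞) {π : PMF α}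
    (hπ : π.bind P = π) : lexpect π f ≤ b := by
  have htrunc : ∀ c : ℝ≥0∞, c ≠ ∞ → lexpect π ({a | W a ≤ c}.indicator f) ≤ b := by
    intro c hc
    set Wc : α → ℝ≥0∞ := fun a => min (W a) c
    have hWc : lexpect π Wc ≠ ∞ :=
      ne_top_of_le_ne_top hc ((lexpect_min_const_le π W c).trans (min_le_right _ _))
    have hdrift : HasDrift P Wc ({a | W a ≤ c}.indicator f) b := by
      intro a
      have hPW := lexpect_min_const_le (P a) W c
      by_cases ha : W a ≤ c
      · rw [Set.indicator_of_mem (by exact ha), show Wc a = W a from min_eq_left ha]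
        exact (add_le_add_left (hPW.trans (min_le_left _ _)) _).trans (h a)
      · rw [Set.indicator_of_notMem (by exact ha), show Wc a = c from min_eq_right (not_le.1 ha).le,
          add_zero]
        exact le_add_right (hPW.trans (min_le_right _ _))
    have hπdrift := hdrift.lexpect_bind_add_le π
    rwa [hπ, ENNReal.add_le_add_iff_left hWc] at hπdrift
  rw [lexpect, ENNReal.tsum_eq_iSup_sum]
  refine iSup_le fun s => ?_
  have hs : s.sup W ≠ ∞ := ((Finset.sup_lt_iff ENNReal.zero_lt_top).2 fun a _ =>
    (hW a).lt_top).ne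
  refine le_trans ?_ ((ENNReal.sum_le_tsum s).trans (htrunc _ hs))
  refine Finset.sum_le_sum fun a ha => ?_
  have hmem : a ∈ {x | W x ≤ s.sup W} := Finset.le_sup (f := W) ha
  rw [Set.indicator_of_mem hmem]

theorem exists_bind_eq (h : HasDrift P W f b) (hb : b ≠ ∞) (hf : ∀ n : ℕ, {a | f a ≤ n}.Finite)
    {μ : PMF α} (hμ : lexpect μ W ≠ ∞) : ∃ π : PMF α, π.bind P = π := by
  have hbound : ∀ K, lexpect (occupationLaw P μ K) f ≤ lexpect μ W + b := fun K => by
    rw [lexpect_occupationLaw]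
    refine (h.average_le μ K.succ_ne_zero).trans (add_le_add_left ?_ b)
    exact ENNReal.div_le_of_le_mul (le_mul_of_one_le_right' (by simp))
  obtain ⟨π, hπ⟩ := exists_pmf_tendsto_of_lexpect_le (hyperfilter ℕ)
    (ENNReal.add_ne_top.2 ⟨hμ, hb⟩) hf hbound
  have hδ : Tendsto (fun K : ℕ => 1 / ((K + 1 : ℕ) : ℝ≥0∞)) (hyperfilter ℕ) (𝓝 0) :=
    ((tendsto_const_div_natCast ENNReal.one_ne_top).comp (tendsto_add_atTop_nat 1)).mono_left
      Nat.hyperfilter_le_atTop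
  exact ⟨π, bind_eq_self_of_tendsto hδ hπ (occupationLaw_bind_apply_le P μ)⟩

end HasDrift

theorem IsAssignment.sum_sum_le {ι : Type*} [Fintype ι] {L : ℕ} {M : Matrix ι (Fin L) ℕ}
    (hM : IsAssignment M) : ∑ i, ∑ s, M i s ≤ L :=
  calc ∑ i, ∑ s, M i s = ∑ s, ∑ i, M i s := Finset.sum_comm
    _ ≤ ∑ _s : Fin L, 1 := Finset.sum_le_sum fun s _ => hM.2.2 s
    _ = L := by simp

theorem finite_setOf_sum_le {ι : Type*} [Fintype ι] (n : ℕ) :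
    {Q : ι → ℕ | ∑ i, Q i ≤ n}.Finite := by
  refine (Set.Finite.pi' fun _ : ι => Set.finite_Iic n).subset fun Q hQ i => ?_
  exact (Finset.single_le_sum (fun _ _ => Nat.zero_le _) (Finset.mem_univ i)).trans hQ

theorem sq_add_sub_add_two_mul_le (a r s : ℕ) :
    (a + r - s) ^ 2 + 2 * (a * s) ≤ a ^ 2 + s ^ 2 + (2 * a * r + r ^ 2) := by
  have htrunc : (a + r - s) ^ 2 + 2 * ((a + r) * s) ≤ (a + r) ^ 2 + s ^ 2 := by
    rcases le_total s (a + r) with h | h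
    · obtain ⟨t, ht⟩ := Nat.exists_eq_add_of_le h
      rw [ht, Nat.add_sub_cancel_left]
      exact (by ring : _ = _).le
    · rw [Nat.sub_eq_zero_of_le h]
      nlinarith [two_mul_le_add_sq (a + r) s]
  nlinarith [Nat.zero_le (r * s)]

namespace AdModel

variable {κ ι : Type*} [Fintype κ] [Fintype ι] {A : AdModel κ ι}

section Requirements

/-- Second moment of `roundingLaw x`, in the form in which the requirements enter `D₁`. -/
noncomputable def roundingSecondMoment (x : ℝ) : ℝ :=
  (⌈x⌉ : ℝ) ^ 2 * (x - (⌊x⌋ : ℝ)) + (⌊x⌋ : ℝ) ^ 2 * (1 - x + (⌊x⌋ : ℝ))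

theorem one_sub_add_floor_nonneg (x : ℝ) : 0 ≤ 1 - x + ⌊x⌋ := by
  linarith [Int.lt_floor_add_one x]

theorem roundingSecondMoment_nonneg (x : ℝ) : 0 ≤ roundingSecondMoment x := by
  have hfract : 0 ≤ x - ⌊x⌋ := Int.fract_nonneg x
  have := one_sub_add_floor_nonneg x
  unfold roundingSecondMoment
  positivity

theorem lexpect_roundingLaw (x : ℝ) (f : ℕ → ℕ) :
    lexpect (roundingLaw x) (fun n => (f n : ℝ≥0∞))
      = ENNReal.ofReal (f ⌈x⌉₊ * (x - ⌊x⌋) + f ⌊x⌋₊ * (1 - x + ⌊x⌋)) := by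
  have hfract : 0 ≤ x - ⌊x⌋ := Int.fract_nonneg x
  have hfract' := one_sub_add_floor_nonneg x
  rw [roundingLaw, lexpect_map, lexpect, tsum_fintype, Fintype.sum_bool,
    ENNReal.ofReal_add (by positivity) (by positivity), ENNReal.ofReal_mul (Nat.cast_nonneg _),
    ENNReal.ofReal_mul (Nat.cast_nonneg _), ENNReal.ofReal_natCast, ENNReal.ofReal_natCast]
  simp [mul_comm, sub_add]

theorem ceil_mul_fract_add_floor_mul (x : ℝ) :
    (⌈x⌉ : ℝ) * (x - ⌊x⌋) + ⌊x⌋ * (1 - x + ⌊x⌋) = x := by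
  rcases eq_or_ne (Int.fract x) 0 with hx | hx
  · have hfract : x - ⌊x⌋ = 0 := hx
    linear_combination ((⌈x⌉ : ℝ) - ⌊x⌋ - 1) * hfract
  · rw [Int.ceil_eq_add_one_sub_fract hx, Int.fract]
    ring

theorem lexpect_reqLaw_apply (i : ι) :
    lexpect A.reqLaw (fun r => (r i : ℝ≥0∞)) = ENNReal.ofReal (A.m i) := by
  rw [← lexpect_map A.reqLaw (fun r => r i) fun n => (n : ℝ≥0∞), A.reqLaw_marginal,
    lexpect_roundingLaw, natCast_ceil_eq_intCast_ceil (A.m_nonneg i),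
    natCast_floor_eq_intCast_floor (A.m_nonneg i), ceil_mul_fract_add_floor_mul]

theorem lexpect_reqLaw_apply_sq (i : ι) :
    lexpect A.reqLaw (fun r => ((r i ^ 2 : ℕ) : ℝ≥0∞))
      = ENNReal.ofReal (roundingSecondMoment (A.m i)) := by
  rw [← lexpect_map A.reqLaw (fun r => r i) fun n => ((n ^ 2 : ℕ) : ℝ≥0∞), A.reqLaw_marginal,
    lexpect_roundingLaw, Nat.cast_pow, Nat.cast_pow, natCast_ceil_eq_intCast_ceil (A.m_nonneg i),
    natCast_floor_eq_intCast_floor (A.m_nonneg i), roundingSecondMoment]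

theorem lexpect_reqLaw_sum (Q : ι → ℕ) :
    lexpect A.reqLaw (fun r => ((∑ i, (2 * Q i * r i + r i ^ 2) : ℕ) : ℝ≥0∞))
      = ENNReal.ofReal (∑ i, (2 * Q i * A.m i + roundingSecondMoment (A.m i))) := by
  have hm : ∀ i, 0 ≤ 2 * Q i * A.m i := fun i => by
    have := A.m_nonneg i
    positivity
  rw [ENNReal.ofReal_sum_of_nonneg fun i _ => add_nonneg (hm i) (roundingSecondMoment_nonneg _)]
  simp_rw [Nat.cast_sum, lexpect_finsetSum, Nat.cast_add, lexpect_add, lexpect_reqLaw_apply_sq,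
    Nat.cast_mul _ (_ : ℕ), lexpect_const_mul, lexpect_reqLaw_apply]
  refine Finset.sum_congr rfl fun i _ => ?_
  rw [ENNReal.ofReal_add (hm i) (roundingSecondMoment_nonneg _),
    ENNReal.ofReal_mul (by positivity)]
  norm_cast

end Requirements

section Queries

theorem rate_nonneg (q : κ) : 0 ≤ A.rate q := mul_nonneg A.arrival_pos.le (A.share_nonneg q)

theorem lexpect_cycleQueryLaw_apply (j : Fin A.N) (g : Option κ → ℝ≥0∞) :
    lexpect A.cycleQueryLaw (fun u => g (u j)) = lexpect A.queryLaw g := by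
  classical
  have hprod : ∀ u : Fin A.N → Option κ, A.cycleQueryLaw u * g (u j)
      = ∏ j', A.queryLaw (u j') * (if j' = j then g (u j') else 1) := fun u => by
    rw [Finset.prod_mul_distrib, Finset.prod_ite_eq' Finset.univ j fun j' => g (u j')]
    simp [cycleQueryLaw]
  have hother : ∀ j' ≠ j, ∑ o, A.queryLaw o * (if j' = j then g o else 1) = 1 := fun j' hj' => by
    simpa [hj'] using A.queryLaw.tsum_coe
  rw [lexpect, tsum_fintype, lexpect, tsum_fintype]
  simp_rw [hprod]
  rw [← Fintype.piFinset_univ, ← Finset.prod_univ_sum (fun _ => Finset.univ)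
    (fun j' o => A.queryLaw o * (if j' = j then g o else 1)),
    Finset.prod_eq_single j (fun j' _ => hother j') (by simp)]
  simp

theorem lexpect_queryLaw_elim (n : κ → ℕ) :
    lexpect A.queryLaw (fun o => ((o.elim 0 n : ℕ) : ℝ≥0∞))
      = ENNReal.ofReal (∑ q, A.rate q * n q) := by
  rw [ENNReal.ofReal_sum_of_nonneg fun q _ => mul_nonneg (rate_nonneg q) (Nat.cast_nonneg _),
    lexpect, tsum_fintype, Fintype.sum_option]
  simp [queryLaw, ENNReal.ofReal_mul (rate_nonneg _)]

end Queries

section AveragePolicy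

variable {rule : A.Rule} {Q : ι → ℕ}

open Classical in
/-- The randomized policy that uses, for a query `q`, the matrix chosen by the rule in a uniformly
random time slot of the cycle; it turns statements on the online algorithm in one cycle into
statements on the static problem. -/
noncomputable def averagePolicy (rule : A.Rule) (Q : ι → ℕ) : A.Policy :=
  fun q M => (∑ j, if rule j q Q = M.1 then 1 else 0) / A.N

theorem sum_averagePolicy_mul (hrule : ∀ j q, rule j q Q ∈ A.mats q) (q : κ)
    (g : Matrix ι (Fin A.L) ℕ → ℝ) :
    ∑ M : {M // M ∈ A.mats q}, averagePolicy rule Q q M * g M.1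
      = (∑ j, g (rule j q Q)) / A.N := by
  classical
  simp only [averagePolicy, div_mul_eq_mul_div, ← Finset.sum_div, Finset.sum_mul]
  rw [Finset.sum_comm]
  congr 1
  refine Finset.sum_congr rfl fun j _ => ?_
  rw [Finset.sum_eq_single ⟨rule j q Q, hrule j q⟩]
  · simp
  · rintro M - hM
    rw [if_neg fun h => hM (Subtype.ext h.symm), zero_mul]
  · simp

theorem averagePolicy_mem_relaxedFeasible (hrule : ∀ j q, rule j q Q ∈ A.mats q) :
    averagePolicy rule Q ∈ A.relaxedFeasible := by
  have hnonneg : ∀ q M, 0 ≤ averagePolicy rule Q q M := fun q M =>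
    div_nonneg (Finset.sum_nonneg fun j _ => by split_ifs <;> norm_num) (Nat.cast_nonneg _)
  have hsum : ∀ q, ∑ M, averagePolicy rule Q q M = 1 := fun q => by
    simpa [A.N_pos.ne'] using sum_averagePolicy_mul hrule q fun _ => 1
  refine ⟨fun q M => ⟨hnonneg q M, ?_⟩, fun q => (hsum q).le⟩
  exact (Finset.single_le_sum (fun M _ => hnonneg q M) (Finset.mem_univ M)).trans_eq (hsum q)

theorem impressions_averagePolicy (hrule : ∀ j q, rule j q Q ∈ A.mats q) (i : ι) :
    A.impressions (averagePolicy rule Q) i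
      = ∑ j, ∑ q, A.rate q * ((∑ s, rule j q Q i s : ℕ) : ℝ) := by
  simp_rw [impressions, sum_averagePolicy_mul hrule _ fun M => ∑ s, (M i s : ℝ)]
  rw [Finset.sum_comm, Finset.mul_sum]
  refine Finset.sum_congr rfl fun q _ => ?_
  rw [← Finset.mul_sum, mul_left_comm, mul_div_cancel₀ _ (Nat.cast_ne_zero.2 A.N_pos.ne')]
  push_cast
  rfl

theorem impressions_averagePolicy_nonneg (hrule : ∀ j q, rule j q Q ∈ A.mats q) (i : ι) :
    0 ≤ A.impressions (averagePolicy rule Q) i := by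
  rw [impressions_averagePolicy hrule]
  exact Finset.sum_nonneg fun j _ => Finset.sum_nonneg fun q _ =>
    mul_nonneg (rate_nonneg q) (Nat.cast_nonneg _)

theorem lexpect_served (hrule : ∀ j q, rule j q Q ∈ A.mats q) (i : ι) :
    lexpect A.cycleQueryLaw (fun u => (served rule Q u i : ℝ≥0∞))
      = ENNReal.ofReal (A.impressions (averagePolicy rule Q) i) := by
  rw [impressions_averagePolicy hrule, ENNReal.ofReal_sum_of_nonneg fun j _ =>
    Finset.sum_nonneg fun q _ => mul_nonneg (rate_nonneg q) (Nat.cast_nonneg _)]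
  have hserved : (fun u => (served rule Q u i : ℝ≥0∞))
      = fun u => ∑ j, (((u j).elim 0 fun q => ∑ s, rule j q Q i s : ℕ) : ℝ≥0∞) :=
    funext fun u => Nat.cast_sum _ _
  rw [hserved, lexpect_finsetSum]
  refine Finset.sum_congr rfl fun j _ => ?_
  let shown : Option κ → ℕ := fun o => o.elim 0 fun q => ∑ s, rule j q Q i s
  exact (lexpect_cycleQueryLaw_apply j fun o => (shown o : ℝ≥0∞)).trans (lexpect_queryLaw_elim _)

end AveragePolicy

section Optimality

/-- The weight that the online algorithm maximizes over the admitted matrices. -/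
noncomputable def weight (A : AdModel κ ι) (ε : ℝ) (Q : ι → ℕ) (q : κ)
    (M : Matrix ι (Fin A.L) ℕ) : ℝ :=
  ∑ i, ∑ s, (M i s : ℝ) * (A.ctr q i s / ε + (Q i : ℝ))

theorem weight_nonneg {ε : ℝ} (hε : 0 ≤ ε) (Q : ι → ℕ) (q : κ) (M : Matrix ι (Fin A.L) ℕ) :
    0 ≤ A.weight ε Q q M :=
  Finset.sum_nonneg fun i _ => Finset.sum_nonneg fun s _ => by
    have := A.ctr_nonneg q i s
    positivity

theorem sum_rate_mul_weight (ε : ℝ) (Q : ι → ℕ) (p : A.Policy) :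
    A.N * ∑ q, A.rate q * ∑ M, p q M * A.weight ε Q q M.1
      = A.N * A.clickRate p / ε + ∑ i, Q i * A.impressions p i := by
  have hweight : ∀ q M, A.weight ε Q q M
      = (∑ i, ∑ s, (M i s : ℝ) * A.ctr q i s) / ε + ∑ i, (Q i : ℝ) * ∑ s, (M i s : ℝ) := by
    intro q M
    simp_rw [weight, Finset.sum_div, Finset.mul_sum, ← Finset.sum_add_distrib]
    exact Finset.sum_congr rfl fun i _ => Finset.sum_congr rfl fun s _ => by ring
  have himpressions : ∑ i, Q i * A.impressions p i = A.N * ∑ q, A.rate q *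
      ∑ M : {M // M ∈ A.mats q}, p q M * ∑ i, (Q i : ℝ) * ∑ s, (M.1 i s : ℝ) := by
    simp_rw [impressions, Finset.mul_sum]
    rw [Finset.sum_comm]
    refine Finset.sum_congr rfl fun q _ => ?_
    rw [Finset.sum_comm]
    exact Finset.sum_congr rfl fun M _ => Finset.sum_congr rfl fun i _ =>
      Finset.sum_congr rfl fun s _ => by ring
  rw [himpressions, clickRate, mul_div_assoc, ← mul_add, Finset.sum_div,
    ← Finset.sum_add_distrib]
  congr 1
  refine Finset.sum_congr rfl fun q _ => ?_
  simp_rw [hweight, mul_add, Finset.sum_add_distrib]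
  rw [mul_add, mul_div_assoc, Finset.sum_div]
  simp_rw [mul_div_assoc]

theorem sum_mul_weight_le_averagePolicy {ε : ℝ} (hε : 0 ≤ ε) {rule : A.Rule}
    (hrule : A.IsOnline ε rule) {p : A.Policy} (hp : p ∈ A.relaxedFeasible) (Q : ι → ℕ) (q : κ) :
    ∑ M, p q M * A.weight ε Q q M.1 ≤ ∑ M, averagePolicy rule Q q M * A.weight ε Q q M.1 := by
  have hslot : ∀ j, ∑ M, p q M * A.weight ε Q q M.1 ≤ A.weight ε Q q (rule j q Q) := fun j =>
    calc ∑ M, p q M * A.weight ε Q q M.1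
        ≤ ∑ M, p q M * A.weight ε Q q (rule j q Q) :=
          Finset.sum_le_sum fun M _ =>
            mul_le_mul_of_nonneg_left ((hrule j q Q).2 M.1 M.2) (hp.1 q M).1
      _ = (∑ M, p q M) * A.weight ε Q q (rule j q Q) := (Finset.sum_mul ..).symm
      _ ≤ A.weight ε Q q (rule j q Q) :=
          mul_le_of_le_one_left (weight_nonneg hε Q q _) (hp.2 q)
  rw [sum_averagePolicy_mul (fun j q => (hrule j q Q).1), le_div_iff₀' (Nat.cast_pos.2 A.N_pos)]
  simpa using Finset.sum_le_sum fun j (_ : j ∈ Finset.univ) => hslot j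

theorem clickRate_nonneg {p : A.Policy} (hp : p ∈ A.relaxedFeasible) : 0 ≤ A.clickRate p :=
  Finset.sum_nonneg fun q _ => mul_nonneg (rate_nonneg q) <| Finset.sum_nonneg fun M _ =>
    mul_nonneg (hp.1 q M).1 <| Finset.sum_nonneg fun i _ => Finset.sum_nonneg fun s _ =>
      mul_nonneg (Nat.cast_nonneg _) (A.ctr_nonneg q i s)

theorem N_mul_clickRate_le_D₃ {p : A.Policy} (hp : p ∈ A.relaxedFeasible) :
    A.N * A.clickRate p ≤ A.D₃ :=
  mul_le_mul_of_nonneg_left (A.isGreatest_clickRate.2 ⟨p, hp, rfl⟩) (Nat.cast_nonneg _)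

theorem D₃_nonneg : 0 ≤ A.D₃ := by
  obtain ⟨p, hp⟩ := A.relaxedFeasible_nonempty
  exact (mul_nonneg (Nat.cast_nonneg _) (clickRate_nonneg hp)).trans (N_mul_clickRate_le_D₃ hp)

theorem sum_mul_impressions_le {ε : ℝ} (hε : 0 ≤ ε) {rule : A.Rule} (hrule : A.IsOnline ε rule)
    {p : A.Policy} (hp : p ∈ A.relaxedFeasible) (Q : ι → ℕ) :
    ∑ i, Q i * A.impressions p i
      ≤ ∑ i, Q i * A.impressions (averagePolicy rule Q) i + A.D₃ / ε := by
  have havg := averagePolicy_mem_relaxedFeasible fun j q => (hrule j q Q).1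
  calc ∑ i, Q i * A.impressions p i
      ≤ A.N * A.clickRate p / ε + ∑ i, Q i * A.impressions p i :=
        le_add_of_nonneg_left
          (div_nonneg (mul_nonneg (Nat.cast_nonneg _) (clickRate_nonneg hp)) hε)
    _ ≤ A.N * A.clickRate (averagePolicy rule Q) / ε
          + ∑ i, Q i * A.impressions (averagePolicy rule Q) i := by
        rw [← sum_rate_mul_weight, ← sum_rate_mul_weight]
        exact mul_le_mul_of_nonneg_left (Finset.sum_le_sum fun q _ =>
          mul_le_mul_of_nonneg_left (sum_mul_weight_le_averagePolicy hε hrule hp Q q)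
            (rate_nonneg q)) (Nat.cast_nonneg _)
    _ ≤ ∑ i, Q i * A.impressions (averagePolicy rule Q) i + A.D₃ / ε := by
        rw [add_comm]
        gcongr
        exact N_mul_clickRate_le_D₃ havg

theorem D₂max_mul_sum_add_le [Nonempty ι] {ε : ℝ} (hε : 0 ≤ ε) {rule : A.Rule}
    (hrule : A.IsOnline ε rule) (Q : ι → ℕ) :
    A.D₂max * ∑ i, (Q i : ℝ) + ∑ i, Q i * A.m i
      ≤ ∑ i, Q i * A.impressions (averagePolicy rule Q) i + A.D₃ / ε := by
  obtain ⟨p, hp, hpD⟩ := A.isGreatest_D₂max.1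
  have hsurplus : ∀ i, A.D₂max + A.m i ≤ A.impressions p i := fun i => by
    have : A.D₂ p ≤ A.impressions p i - A.m i := Finset.inf'_le _ (Finset.mem_univ i)
    linarith
  calc A.D₂max * ∑ i, (Q i : ℝ) + ∑ i, Q i * A.m i
      = ∑ i, Q i * (A.D₂max + A.m i) := by
        simp only [mul_add, Finset.sum_add_distrib, ← Finset.sum_mul, mul_comm A.D₂max]
    _ ≤ ∑ i, Q i * A.impressions p i := by
        gcongr with i
        exact hsurplus i
    _ ≤ _ := sum_mul_impressions_le hε hrule hp Q

end Optimality

section Drift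

variable {rule : A.Rule} {Q : ι → ℕ}

theorem served_le (hrule : ∀ j q, rule j q Q ∈ A.mats q) (u : Fin A.N → Option κ) (i : ι) :
    served rule Q u i ≤ A.N := by
  have hslot : ∀ j, (u j).elim 0 (fun q => ∑ s, rule j q Q i s) ≤ 1 := fun j => by
    cases u j with
    | none => exact zero_le_one
    | some q => exact (A.isAssignment_of_mem q _ (hrule j q)).2.1 i
  simpa [served] using Finset.sum_le_sum fun j (_ : j ∈ Finset.univ) => hslot j

theorem sum_served_le (hrule : ∀ j q, rule j q Q ∈ A.mats q) (u : Fin A.N → Option κ) :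
    ∑ i, served rule Q u i ≤ A.N * A.L := by
  have hslot : ∀ j, ∑ i, (u j).elim 0 (fun q => ∑ s, rule j q Q i s) ≤ A.L := fun j => by
    cases u j with
    | none => simp
    | some q =>
      exact (A.isAssignment_of_mem q _ (hrule j q)).sum_sum_le
  unfold served
  rw [Finset.sum_comm]
  simpa using Finset.sum_le_sum fun j (_ : j ∈ Finset.univ) => hslot j

theorem sum_served_sq_le (hrule : ∀ j q, rule j q Q ∈ A.mats q) (u : Fin A.N → Option κ) :
    ∑ i, served rule Q u i ^ 2 ≤ A.N ^ 2 * A.L := by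
  calc ∑ i, served rule Q u i ^ 2
      ≤ ∑ i, A.N * served rule Q u i := Finset.sum_le_sum fun i _ => by
        rw [sq]
        exact Nat.mul_le_mul_right _ (served_le hrule u i)
    _ = A.N * ∑ i, served rule Q u i := (Finset.mul_sum ..).symm
    _ ≤ A.N * (A.N * A.L) := Nat.mul_le_mul_left _ (sum_served_le hrule u)
    _ = A.N ^ 2 * A.L := by ring

theorem sum_update_sq_add_le (hrule : ∀ j q, rule j q Q ∈ A.mats q) (u : Fin A.N → Option κ)
    (r : ι → ℕ) :
    ∑ i, update rule Q u r i ^ 2 + 2 * ∑ i, Q i * served rule Q u i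
      ≤ ∑ i, Q i ^ 2 + A.N ^ 2 * A.L + ∑ i, (2 * Q i * r i + r i ^ 2) := by
  have hsum : ∑ i, (update rule Q u r i ^ 2 + 2 * (Q i * served rule Q u i))
      ≤ ∑ i, (Q i ^ 2 + served rule Q u i ^ 2 + (2 * Q i * r i + r i ^ 2)) :=
    Finset.sum_le_sum fun i _ => sq_add_sub_add_two_mul_le _ _ _
  rw [Finset.sum_add_distrib, Finset.sum_add_distrib, Finset.sum_add_distrib,
    ← Finset.mul_sum] at hsum
  have := sum_served_sq_le hrule u
  lia

theorem lexpect_step (rule : A.Rule) (Q : ι → ℕ) (f : (ι → ℕ) → ℝ≥0∞) :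
    lexpect (step rule Q) f
      = lexpect A.cycleQueryLaw fun u => lexpect A.reqLaw fun r => f (update rule Q u r) := by
  simp only [step, lexpect_bind, lexpect_map]

theorem lexpect_sum_mul_served (hrule : ∀ j q, rule j q Q ∈ A.mats q) :
    lexpect A.cycleQueryLaw (fun u => ((∑ i, Q i * served rule Q u i : ℕ) : ℝ≥0∞))
      = ENNReal.ofReal (∑ i, Q i * A.impressions (averagePolicy rule Q) i) := by
  rw [ENNReal.ofReal_sum_of_nonneg fun i _ =>
    mul_nonneg (Nat.cast_nonneg _) (impressions_averagePolicy_nonneg hrule i)]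
  simp_rw [Nat.cast_sum, Nat.cast_mul, lexpect_finsetSum, lexpect_const_mul,
    lexpect_served hrule, ENNReal.ofReal_mul (Nat.cast_nonneg _), ENNReal.ofReal_natCast]

theorem sq_mul_add_sum_roundingSecondMoment_le :
    (A.N : ℝ) ^ 2 * A.L + ∑ i, roundingSecondMoment (A.m i) ≤ 2 * A.D₁ := by
  have hN : (1 : ℝ) ≤ A.N := Nat.one_le_cast.2 A.N_pos
  have hL : (A.L : ℝ) ≤ (A.L : ℝ) ^ 2 := by exact_mod_cast Nat.le_self_pow two_ne_zero A.L
  have hNL : (A.N : ℝ) * (A.N - 1) * A.L ≤ A.N * (A.N - 1) * A.L ^ 2 :=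
    mul_le_mul_of_nonneg_left hL (mul_nonneg (by linarith) (by linarith))
  have hD₁ : A.D₁ = 1 / 2 * ((A.N : ℝ) * (A.N - 1) * (A.L : ℝ) ^ 2 + A.N * A.L
      + ∑ i, roundingSecondMoment (A.m i)) := rfl
  linarith

theorem D₁_nonneg : 0 ≤ A.D₁ := by
  have hsum := Finset.sum_nonneg fun i (_ : i ∈ Finset.univ) => roundingSecondMoment_nonneg (A.m i)
  have hNL : (0 : ℝ) ≤ (A.N : ℝ) ^ 2 * A.L := by positivity
  linarith [sq_mul_add_sum_roundingSecondMoment_le (A := A)]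

theorem lexpect_step_sum_sq_add_le (hrule : ∀ j q, rule j q Q ∈ A.mats q) :
    lexpect (step rule Q) (fun x => ((∑ i, x i ^ 2 : ℕ) : ℝ≥0∞))
        + ENNReal.ofReal (2 * ∑ i, Q i * A.impressions (averagePolicy rule Q) i)
      ≤ ((∑ i, Q i ^ 2 : ℕ) : ℝ≥0∞) + ENNReal.ofReal (2 * ∑ i, Q i * A.m i + 2 * A.D₁) := by
  have hreq : 0 ≤ ∑ i, (2 * Q i * A.m i + roundingSecondMoment (A.m i)) :=
    Finset.sum_nonneg fun i _ => add_nonneg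
      (mul_nonneg (by positivity) (A.m_nonneg i)) (roundingSecondMoment_nonneg _)
  calc _ = lexpect A.cycleQueryLaw fun u => lexpect A.reqLaw fun r =>
          ((∑ i, update rule Q u r i ^ 2 + 2 * ∑ i, Q i * served rule Q u i : ℕ) : ℝ≥0∞) := by
        simp_rw [Nat.cast_add _ (2 * _), lexpect_add, lexpect_const, Nat.cast_mul 2,
          lexpect_const_mul, lexpect_sum_mul_served hrule, lexpect_step]
        rw [ENNReal.ofReal_mul zero_le_two]
        simp
    _ ≤ lexpect A.cycleQueryLaw fun _ => lexpect A.reqLaw fun r =>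
          ((∑ i, Q i ^ 2 + A.N ^ 2 * A.L + ∑ i, (2 * Q i * r i + r i ^ 2) : ℕ) : ℝ≥0∞) :=
        lexpect_mono _ fun u => lexpect_mono _ fun r =>
          Nat.cast_le.2 (sum_update_sq_add_le hrule u r)
    _ = ((∑ i, Q i ^ 2 : ℕ) : ℝ≥0∞) + ENNReal.ofReal
          ((A.N ^ 2 * A.L : ℕ) + ∑ i, (2 * Q i * A.m i + roundingSecondMoment (A.m i))) := by
        rw [lexpect_const, ENNReal.ofReal_add (Nat.cast_nonneg _) hreq, ENNReal.ofReal_natCast,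
          ← lexpect_reqLaw_sum, ← add_assoc, ← Nat.cast_add]
        simp_rw [Nat.cast_add _ (Finset.sum _ _), lexpect_add, lexpect_const]
    _ ≤ _ := by
        refine add_le_add_right (ENNReal.ofReal_le_ofReal ?_) _
        rw [Finset.sum_add_distrib]
        simp_rw [mul_assoc, ← Finset.mul_sum]
        push_cast
        linarith [sq_mul_add_sum_roundingSecondMoment_le (A := A)]

theorem hasDrift_step [Nonempty ι] {ε : ℝ} (hε : 0 ≤ ε) (hD : 0 ≤ A.D₂max)
    (hrule : A.IsOnline ε rule) :
    HasDrift (step rule) (fun Q => ((∑ i, Q i ^ 2 : ℕ) : ℝ≥0∞))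
      (fun Q => ENNReal.ofReal (2 * A.D₂max) * ((∑ i, Q i : ℕ) : ℝ≥0∞))
      (ENNReal.ofReal (2 * (A.D₁ + A.D₃ / ε))) := by
  intro Q
  have hmem : ∀ j q, rule j q Q ∈ A.mats q := fun j q => (hrule j q Q).1
  set service := ∑ i, Q i * A.impressions (averagePolicy rule Q) i
  set demand := ∑ i, Q i * A.m i
  set total : ℝ := ∑ i, (Q i : ℝ)
  have hservice : 0 ≤ service := Finset.sum_nonneg fun i _ =>
    mul_nonneg (Nat.cast_nonneg _) (impressions_averagePolicy_nonneg hmem i)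
  have hdemand : 0 ≤ demand := Finset.sum_nonneg fun i _ =>
    mul_nonneg (Nat.cast_nonneg _) (A.m_nonneg i)
  have hD₁ : 0 ≤ A.D₁ := D₁_nonneg
  have hD₃ : 0 ≤ A.D₃ / ε := div_nonneg D₃_nonneg hε
  have hcast : ENNReal.ofReal (2 * A.D₂max) * ((∑ i, Q i : ℕ) : ℝ≥0∞)
      = ENNReal.ofReal (2 * A.D₂max * total) := by
    rw [ENNReal.ofReal_mul (p := 2 * A.D₂max) (by positivity), ← ENNReal.ofReal_natCast,
      Nat.cast_sum]
  beta_reduce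
  rw [hcast, ← ENNReal.add_le_add_iff_right (ENNReal.ofReal_ne_top (r := 2 * service)),
    add_right_comm]
  refine (add_le_add_left (lexpect_step_sum_sq_add_le hmem) _).trans ?_
  rw [add_assoc, add_assoc, ← ENNReal.ofReal_add (by positivity) (by positivity),
    ← ENNReal.ofReal_add (by positivity) (by positivity)]
  refine add_le_add_right (ENNReal.ofReal_le_ofReal ?_) _
  linarith [D₂max_mul_sum_add_le hε hrule Q]

theorem hasDrift_sum [Nonempty ι] {ε : ℝ} (hε : 0 ≤ ε) (hD : 0 < A.D₂max)
    (hrule : A.IsOnline ε rule) :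
    HasDrift (step rule)
      (fun Q => (ENNReal.ofReal (2 * A.D₂max))⁻¹ * ((∑ i, Q i ^ 2 : ℕ) : ℝ≥0∞))
      (fun Q => ((∑ i, Q i : ℕ) : ℝ≥0∞)) (ENNReal.ofReal ((A.D₁ + A.D₃ / ε) / A.D₂max)) := by
  have hD' : 0 < 2 * A.D₂max := by positivity
  convert (hasDrift_step hε hD.le hrule).const_mul (ENNReal.ofReal (2 * A.D₂max))⁻¹ using 1
  · funext Q
    rw [← mul_assoc, ENNReal.inv_mul_cancel (ENNReal.ofReal_pos.2 hD').ne' ENNReal.ofReal_ne_top,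
      one_mul]
  · rw [← ENNReal.ofReal_inv_of_pos hD', ← ENNReal.ofReal_mul (by positivity)]
    congr 1
    field_simp

end Drift

theorem queueLaw_eq_chainLaw (rule : A.Rule) (Q₀ : ι → ℕ) (k : ℕ) :
    queueLaw rule Q₀ k = chainLaw (step rule) (PMF.pure Q₀) k := by
  induction k with
  | zero => rfl
  | succ k ih => rw [queueLaw, ih, chainLaw_succ]

end AdModel

theorem mainTheorem5 {κ ι : Type*} [Fintype κ] [Fintype ι] [Nonempty ι]
    (A : AdModel κ ι) (ε : ℝ) (hε : 0 < ε)
    (hslater : ∃ p ∈ A.feasible, 0 < A.D₂ p)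
    (rule : A.Rule) (hrule : A.IsOnline ε rule) :
    (∃ π : PMF (ι → ℕ), AdModel.IsSteadyState rule π) ∧
    (∀ π : PMF (ι → ℕ), AdModel.IsSteadyState rule π →
      meanTotal π ≤ ENNReal.ofReal ((A.D₁ + A.D₃ / ε) / A.D₂max)) ∧
    (∀ Q₀ : ι → ℕ,
      Filter.limsup (fun K : ℕ =>
          (∑ k ∈ Finset.range K, meanTotal (AdModel.queueLaw rule Q₀ k)) / (K : ENNReal))
        Filter.atTop ≤ ENNReal.ofReal ((A.D₁ + A.D₃ / ε) / A.D₂max)) := by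
  have hD : 0 < A.D₂max := by
    obtain ⟨p, hp, hpD⟩ := hslater
    exact hpD.trans_le (A.isGreatest_D₂max.2 ⟨p, hp.1, rfl⟩)
  set W : (ι → ℕ) → ℝ≥0∞ := fun Q =>
    (ENNReal.ofReal (2 * A.D₂max))⁻¹ * ((∑ i, Q i ^ 2 : ℕ) : ℝ≥0∞)
  have hdrift : HasDrift (AdModel.step rule) W (fun Q => ((∑ i, Q i : ℕ) : ℝ≥0∞)) _ :=
    AdModel.hasDrift_sum hε.le hD hrule
  have hW : ∀ Q, W Q ≠ ∞ := fun Q => ENNReal.mul_ne_top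
    (ENNReal.inv_ne_top.2 (ENNReal.ofReal_pos.2 (by positivity)).ne') (ENNReal.natCast_ne_top _)
  have hinit : ∀ Q₀, lexpect (PMF.pure Q₀) W ≠ ∞ := fun Q₀ => lexpect_pure Q₀ W ▸ hW Q₀
  refine ⟨?_, fun π hπ => hdrift.lexpect_le_of_bind_eq hW hπ, fun Q₀ => ?_⟩
  · exact hdrift.exists_bind_eq ENNReal.ofReal_ne_top
      (fun n => by simpa only [Nat.cast_le] using finite_setOf_sum_le n) (hinit 0)
  · simp_rw [AdModel.queueLaw_eq_chainLaw]
    exact hdrift.limsup_average_le (hinit Q₀)
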